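/- Let $n\ge 0$, write $[n]=\{1,\dots,n\}$, and let $\mathbf 1_i\in\mathbb N^n$ be the $i$-th unit vector and $\operatorname{supp}\mathbf m=\{i:\mathbf m_i\neq 0\}$ for $\mathbf m\in\mathbb N^n$. Let $A$ be a (not necessarily unital) $C^*$-algebra and let $(A,X)$ be a proper $\mathbb N^n$-product system: a family $(X^{\mathbf m})_{\mathbf m\in\mathbb N^n}$ of $A$-$A$-correspondences with $X^{\mathbf 0}=A$, whose left actions are $*$-homomorphisms $\varphi^{\mathbf m}\colon A\to\mathcal K(X^{\mathbf m})$ into the generalized compact operators, together with isomorphisms of correspondences $X^{\mathbf m}\otimes_A X^{\mathbf k}\to X^{\mathbf m+\mathbf k}$, $x\otimes y\mapsto x\cdot y$, for $\mathbf m,\mathbf k\ne\mathbf 0$, which are associative. For a closed two-sided ideal $I\subset A$ let $X^{\mathbf m}I$ be the closed submodule of $X^{\mathbf m}$ spanned by the products $x\cdot a$ with $x\in X^{\mathbf m}$, $a\in I$. Let $X^{\mathbf m}_I=X^{\mathbf m}/X^{\mathbf m}I$ be the quotient Hilbert $A/I$-module, write $[\cdot]_I$ for the quotient maps, and put $(X^{\mathbf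 m})^{-1}(I)=\{a\in A: \varphi^{\mathbf m}(a)X^{\mathbf m}\subset X^{\mathbf m}I\}$. Let $K=\{K^F\}_{F\subset[n]}$ be an invariant family, i.e. a family of closed two-sided ideals of $A$ with \[ K^G=(X^{\mathbf 1_i})^{-1}(K^G\cap K^{G\cup\{i\}})\qquad\text{for all } G\subset[n],\ i\in[n]\setminus G. \] Put $\boldsymbol A_K=\bigoplus_{F\subset[n]}A/K^F$ and let $\boldsymbol X_K^{\mathbf m}=\bigoplus_{F\subset[n]}X^{\mathbf m}_{K^F}$ be the direct sum Hilbert $\boldsymbol A_K$-module. Then there is a proper $\mathbb N^n$-product system $(\boldsymbol A_K,\boldsymbol X_K)$ on the Hilbert modules $\boldsymbol X^{\mathbf m}_K$, $\mathbf m\in\mathbb N^n$, whose left actions are given componentwise by \[ (\varphi_K^{\mathbf m}(\boldsymbol a)\boldsymbol x)_F=\bigl[\varphi^{\mathbf m}(\hat{\boldsymbol a}_{F\setminus\operatorname{supp}\mathbf m})\,\hat{\boldsymbol x}_F\bigr]_{K^F}\qquad(\boldsymbol a\in\boldsymbol A_K,\ \boldsymbol x\in\boldsymbol X_K^{\mathbf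 m},\ F\subset[n]), \] where hats denote arbitrary lifts of the components to $A$ and $X^{\mathbf m}$; that is, $\boldsymbol A_K$ acts on the $F$-component through its summand $A/K^{F\setminus\operatorname{supp}\mathbf m}$. The identification $\boldsymbol X_K^{\mathbf 0}=\boldsymbol A_K$ is induced componentwise by $X^{\mathbf 0}=A$, and the multiplication is \[ (\boldsymbol x\cdot\boldsymbol y)_F=\bigl[\hat{\boldsymbol x}_{F\setminus\operatorname{supp}\mathbf k}\cdot\hat{\boldsymbol y}_F\bigr]_{K^F}\qquad(\boldsymbol x\in\boldsymbol X_K^{\mathbf m},\ \boldsymbol y\in\boldsymbol X_K^{\mathbf k},\ \mathbf m,\mathbf k\neq\mathbf 0,\ F\subset[n]). \] -/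

import Mathlib

open scoped TensorProduct

universe u v w

noncomputable section

/-- A closed two-sided ideal of a `C⋆`-algebra. -/
structure ClosedIdeal (A : Type u) [NonUnitalCStarAlgebra A] extends Submodule ℂ A where
  mul_mem_left' : ∀ (a : A) {b : A}, b ∈ carrier → a * b ∈ carrier
  mul_mem_right' : ∀ {a : A} (b : A), a ∈ carrier → a * b ∈ carrier
  isClosed' : IsClosed carrier

/-- A right Hilbert module `E` over the `C⋆`-algebra `A`. The inner product is linear in the second
variable; the norm and the completeness of `E` are those of the ambient Banach space. An element of
a `C⋆`-algebra is positive exactly when it has the form `b⋆ b`. -/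
class HilbertModule (A : Type u) (E : Type v) [NonUnitalCStarAlgebra A] [NormedAddCommGroup E]
    [NormedSpace ℂ E] where
  /-- The right action `act x a = x · a`. -/
  act : E → A → E
  /-- The inner product. -/
  ip : E → E → A
  add_act : ∀ (x y : E) (a : A), act (x + y) a = act x a + act y a
  act_add : ∀ (x : E) (a b : A), act x (a + b) = act x a + act x b
  smul_act : ∀ (z : ℂ) (x : E) (a : A), act (z • x) a = z • act x a
  act_smul : ∀ (z : ℂ) (x : E) (a : A), act x (z • a) = z • act x a
  act_mul : ∀ (x : E) (a b : A), act x (a * b) = act (act x a) b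
  ip_add : ∀ x y z : E, ip x (y + z) = ip x y + ip x z
  ip_smul : ∀ (z : ℂ) (x y : E), ip x (z • y) = z • ip x y
  star_ip : ∀ x y : E, star (ip x y) = ip y x
  ip_nonneg : ∀ x : E, ∃ b : A, ip x x = star b * b
  ip_act : ∀ (x y : E) (a : A), ip x (act y a) = ip x y * a
  norm_sq : ∀ x : E, ‖x‖ ^ 2 = ‖ip x x‖
  complete : CompleteSpace E

namespace ClosedIdeal

variable {A : Type u} [NonUnitalCStarAlgebra A]

instance isClosed_toSubmodule (I : ClosedIdeal A) : IsClosed (I.toSubmodule : Set A) :=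
  I.isClosed'

/-- Approximate units of a closed ideal, for one element `j` of the ideal. -/
theorem exists_approx (I : ClosedIdeal A) {j : A} (hj : j ∈ I.toSubmodule) {ε : ℝ} (hε : 0 < ε) :
    ∃ e ∈ I.toSubmodule, star e = e ∧ (∀ y : A, ‖y - e * y‖ ≤ ‖y‖) ∧ ‖j - e * j‖ ≤ ε := by
  set b : A := j * star j with hb
  have hbs : star b = b := by simp [hb]
  let B := NonUnitalStarAlgebra.elemental ℂ b
  let _ : PartialOrder B := CStarAlgebra.spectralOrder B
  have : StarOrderedRing B := CStarAlgebra.spectralOrderedRing B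
  let _ : PartialOrder A := CStarAlgebra.spectralOrder A
  have : StarOrderedRing A := CStarAlgebra.spectralOrderedRing A
  -- the elemental algebra lies in the ideal
  let S : NonUnitalStarSubalgebra ℂ A :=
    { carrier := {a | a ∈ I.toSubmodule ∧ star a ∈ I.toSubmodule}
      add_mem' := fun {x y} hx hy => ⟨add_mem hx.1 hy.1, by
        rw [star_add]; exact add_mem hx.2 hy.2⟩
      zero_mem' := ⟨zero_mem _, by rw [star_zero]; exact zero_mem _⟩
      mul_mem' := fun {x y} hx hy => ⟨I.mul_mem_left' _ hy.1, by
        rw [star_mul]; exact I.mul_mem_left' _ hx.2⟩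
      smul_mem' := fun c x hx => ⟨I.toSubmodule.smul_mem c hx.1, by
        rw [star_smul]; exact I.toSubmodule.smul_mem _ hx.2⟩
      star_mem' := fun {x} hx => ⟨hx.2, by rw [star_star]; exact hx.1⟩ }
  have hSc : IsClosed (S : Set A) :=
    IsClosed.inter I.isClosed' (I.isClosed'.preimage continuous_star)
  have hbS : b ∈ S := ⟨I.mul_mem_right' _ hj, by rw [hbs]; exact I.mul_mem_right' _ hj⟩
  have hBS := NonUnitalStarAlgebra.elemental.le_of_mem hSc hbS
  have hbB : b ∈ B := NonUnitalStarAlgebra.elemental.self_mem ℂ b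
  have hu := CStarAlgebra.increasingApproximateUnit B
  have ht : Filter.Tendsto (fun u : B => ‖(⟨b, hbB⟩ : B) - u * ⟨b, hbB⟩‖)
      (CStarAlgebra.approximateUnit B) (nhds 0) := by
    have := (tendsto_const_nhds (x := (⟨b, hbB⟩ : B))).sub (hu.tendsto_mul_right ⟨b, hbB⟩)
    simpa using this.norm
  obtain ⟨u, hu0, hu1, hub⟩ := (hu.eventually_nonneg.and (hu.eventually_norm.and
    (ht.eventually (gt_mem_nhds (show (0 : ℝ) < ε ^ 2 by positivity))))).exists
  obtain ⟨s, hs⟩ := CStarAlgebra.nonneg_iff_eq_star_mul_self.mp hu0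
  have hs' : (u : A) = star (s : A) * (s : A) := by rw [hs]; rfl
  have hstar : star (u : A) = u := by rw [hs']; simp
  have hpos : (0 : A) ≤ (u : A) := by rw [hs']; exact star_mul_self_nonneg _
  have hcontr : ∀ y : A, ‖y - u * y‖ ≤ ‖y‖ := fun y => by
    refine CStarAlgebra.norm_sub_mul_self_le_of_inr (x := 0) y le_rfl hpos hu1 (norm_nonneg _) ?_
    rw [Unitization.inr_zero, sub_zero, mul_one, CStarRing.norm_star_mul_self,
      Unitization.norm_inr, sq]
  refine ⟨u, (hBS u.2).1, hstar, hcontr, ?_⟩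
  have hcontr' : ∀ y : A, ‖y - y * u‖ ≤ ‖y‖ := fun y => by
    have := hcontr (star y)
    rw [← norm_star, ← norm_star y]
    simpa [hstar] using this
  have h1 : ‖j - u * j‖ ^ 2 ≤ ε ^ 2 := by
    rw [sq, ← CStarRing.norm_self_mul_star]
    have : (j - u * j) * star (j - u * j) = (b - u * b) - (b - u * b) * u := by
      simp only [star_sub, star_mul, hstar, hb]; noncomm_ring
    rw [this]
    exact (hcontr' _).trans hub.le
  exact le_of_sq_le_sq h1 hε.le

end ClosedIdeal

namespace HilbertModule

variable {A : Type u} {E : Type v} [NonUnitalCStarAlgebra A] [NormedAddCommGroup E]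
  [NormedSpace ℂ E] [HilbertModule A E]

theorem add_ip (x y z : E) : ip (A := A) (x + y) z = ip x z + ip y z := by
  rw [← star_ip, ip_add, star_add, star_ip, star_ip]

theorem smul_ip (c : ℂ) (x y : E) : ip (A := A) (c • x) y = star c • ip x y := by
  rw [← star_ip, ip_smul, star_smul, star_ip]

theorem act_ip (x y : E) (a : A) : ip (A := A) (act x a) y = star a * ip x y := by
  rw [← star_ip, ip_act, star_mul, star_ip]

variable (A) in
/-- Cauchy-Schwarz. -/
theorem norm_ip_le (x y : E) : ‖ip (A := A) x y‖ ≤ ‖x‖ * ‖y‖ := by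
  let _ : PartialOrder Aᵐᵒᵖ := CStarAlgebra.spectralOrder Aᵐᵒᵖ
  have : StarOrderedRing Aᵐᵒᵖ := CStarAlgebra.spectralOrderedRing Aᵐᵒᵖ
  let _ : SMul Aᵐᵒᵖ E := ⟨fun a x => act x a.unop⟩
  let _ : CStarModule Aᵐᵒᵖ E :=
    { inner := fun x y => MulOpposite.op (ip (A := A) x y)
      inner_add_right := by intro x y z; simp [ip_add]
      inner_self_nonneg := by
        intro x
        obtain ⟨b, hb⟩ := ip_nonneg (A := A) x
        rw [hb, MulOpposite.op_mul, MulOpposite.op_star]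
        exact mul_star_self_nonneg _
      inner_self := by
        intro x
        rw [MulOpposite.op_eq_zero_iff, ← norm_eq_zero, ← norm_sq]
        simp
      inner_op_smul_right := by
        intro a x y
        exact MulOpposite.unop_injective (ip_act x y a.unop)
      inner_smul_right_complex := by intro z x y; simp [ip_smul]
      star_inner := by intro x y; rw [← MulOpposite.op_star, star_ip]
      norm_eq_sqrt_norm_inner_self := by
        intro x
        rw [MulOpposite.norm_op, ← norm_sq, Real.sqrt_sq (norm_nonneg _)] }
  exact CStarModule.norm_inner_le (A := Aᵐᵒᵖ) E (x := x) (y := y)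

theorem norm_act_le (x : E) (a : A) : ‖act x a‖ ≤ ‖x‖ * ‖a‖ := by
  refine le_of_sq_le_sq ?_ (by positivity)
  rw [norm_sq (A := A), ip_act, act_ip]
  calc ‖star a * ip (A := A) x x * a‖ ≤ ‖star a * ip (A := A) x x‖ * ‖a‖ := norm_mul_le _ _
    _ ≤ ‖star a‖ * ‖ip (A := A) x x‖ * ‖a‖ := by gcongr; exact norm_mul_le _ _
    _ = (‖x‖ * ‖a‖) ^ 2 := by rw [norm_star, ← norm_sq]; ring

variable (E) in
/-- Right multiplication by `a` as a bounded operator. -/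
def actL (a : A) : E →L[ℂ] E :=
  LinearMap.mkContinuous
    { toFun := fun x => act x a
      map_add' := fun x y => add_act x y a
      map_smul' := fun c x => smul_act c x a } ‖a‖
    (fun x => by rw [mul_comm]; exact norm_act_le x a)

variable (A) in
/-- Pairing with `x` as a bounded operator. -/
def ipL (x : E) : E →L[ℂ] A :=
  LinearMap.mkContinuous
    { toFun := fun y => ip x y
      map_add' := fun y z => ip_add x y z
      map_smul' := fun c y => ip_smul c x y } ‖x‖
    (fun y => norm_ip_le A x y)

variable (A) in
/-- The rank-one operators `z ↦ x · ⟪y, z⟫` on `E`. -/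
def IsRankOne (T : E →L[ℂ] E) : Prop :=
  ∃ x y : E, ∀ z : E, T z = act x (ip (A := A) y z)

variable (A E) in
/-- The space of (generalized) compact operators: the closed linear span of the rank-one
operators. -/
def compacts : Submodule ℂ (E →L[ℂ] E) :=
  (Submodule.span ℂ {T : E →L[ℂ] E | IsRankOne A T}).topologicalClosure

variable (E) in
/-- The closed submodule `E · I` of `E`, for a closed ideal `I` of `A`. -/
def mulIdeal (I : ClosedIdeal A) : Submodule ℂ E :=
  (Submodule.span ℂ {z : E | ∃ x : E, ∃ a ∈ I.toSubmodule, z = act x a}).topologicalClosure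

instance isClosed_mulIdeal (I : ClosedIdeal A) : IsClosed (mulIdeal E I : Set E) :=
  Submodule.isClosed_topologicalClosure _

theorem act_mem_mulIdeal {I : ClosedIdeal A} (x : E) {a : A} (ha : a ∈ I.toSubmodule) :
    act x a ∈ mulIdeal E I :=
  Submodule.le_topologicalClosure _ (Submodule.subset_span ⟨x, a, ha, rfl⟩)

theorem mulIdeal_induction {F : Type w} [NormedAddCommGroup F] [NormedSpace ℂ F]
    {I : ClosedIdeal A} (f : E →L[ℂ] F) {S : Submodule ℂ F} (hS : IsClosed (S : Set F))
    (h : ∀ (x : E), ∀ a ∈ I.toSubmodule, f (act x a) ∈ S) {z : E} (hz : z ∈ mulIdeal E I) :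
    f z ∈ S := by
  have : mulIdeal E I ≤ S.comap f.toLinearMap :=
    Submodule.topologicalClosure_minimal _
      (Submodule.span_le.2 (by rintro _ ⟨x, a, ha, rfl⟩; exact h x a ha))
      (hS.preimage f.continuous)
  exact this hz

theorem ip_mem_right {I : ClosedIdeal A} (x : E) {z : E} (hz : z ∈ mulIdeal E I) :
    ip (A := A) x z ∈ I.toSubmodule :=
  mulIdeal_induction (ipL A x) I.isClosed'
    (fun y a ha => by
      change ip x (act y a) ∈ _
      rw [ip_act]; exact I.mul_mem_left' _ ha) hz

theorem act_mem_left {I : ClosedIdeal A} {z : E} (hz : z ∈ mulIdeal E I) (a : A) :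
    act z a ∈ mulIdeal E I :=
  mulIdeal_induction (actL E a) (isClosed_mulIdeal I)
    (fun y b hb => by
      change act (act y b) a ∈ _
      rw [← act_mul]; exact act_mem_mulIdeal _ (I.mul_mem_right' _ hb)) hz

/-- A `C⋆`-algebra as a Hilbert module over itself. -/
@[reducible]
def self : HilbertModule A A where
  act x a := x * a
  ip x y := star x * y
  add_act := add_mul
  act_add := mul_add
  smul_act := smul_mul_assoc
  act_smul z x a := mul_smul_comm z x a
  act_mul x a b := (mul_assoc x a b).symm
  ip_add x y z := mul_add _ _ _
  ip_smul z x y := mul_smul_comm z _ y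
  star_ip x y := by simp
  ip_nonneg x := ⟨x, rfl⟩
  ip_act x y a := (mul_assoc _ _ _).symm
  norm_sq x := by rw [CStarRing.norm_star_mul_self, sq]
  complete := inferInstance

end HilbertModule

namespace ClosedIdeal

open HilbertModule

variable {A : Type u} [NonUnitalCStarAlgebra A]

theorem star_mem (I : ClosedIdeal A) {a : A} (ha : a ∈ I.toSubmodule) :
    star a ∈ I.toSubmodule := by
  refine I.isClosed'.closure_subset_iff.2 subset_rfl (Metric.mem_closure_iff.2 fun ε hε => ?_)
  obtain ⟨e, he, hes, -, hj⟩ := I.exists_approx ha (half_pos hε)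
  refine ⟨star a * e, I.mul_mem_left' _ he, ?_⟩
  rw [dist_eq_norm, ← norm_star]
  have : star (star a - star a * e) = a - e * a := by simp [hes]
  rw [this]
  linarith

/-- The quotient `A / I`, with the quotient norm. -/
def Quot (I : ClosedIdeal A) : Type u := A ⧸ I.toSubmodule

variable (I : ClosedIdeal A)

instance : NormedAddCommGroup I.Quot := inferInstanceAs (NormedAddCommGroup (A ⧸ I.toSubmodule))
instance : NormedSpace ℂ I.Quot := inferInstanceAs (NormedSpace ℂ (A ⧸ I.toSubmodule))
instance : CompleteSpace I.Quot := inferInstanceAs (CompleteSpace (A ⧸ I.toSubmodule))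

/-- The quotient map `A → A / I`. -/
def quot : A →ₗ[ℂ] I.Quot := I.toSubmodule.mkQ

theorem quot_surjective : Function.Surjective I.quot := I.toSubmodule.mkQ_surjective

theorem quot_eq {a b : A} : I.quot a = I.quot b ↔ a - b ∈ I.toSubmodule :=
  Submodule.Quotient.eq I.toSubmodule

theorem norm_quot_le (a : A) : ‖I.quot a‖ ≤ ‖a‖ := Submodule.Quotient.norm_mk_le _ a

theorem exists_lift (q : I.Quot) {ε : ℝ} (hε : 0 < ε) : ∃ a, I.quot a = q ∧ ‖a‖ < ‖q‖ + ε :=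
  Submodule.Quotient.norm_mk_lt (S := I.toSubmodule) q hε

instance : Mul I.Quot :=
  ⟨Quotient.map₂ (· * ·) fun a a' h b b' h' => by
    rw [← Quotient.eq_iff_equiv] at h h' ⊢
    have h1 := (I.quot_eq (a := a) (b := a')).1 h
    have h2 := (I.quot_eq (a := b) (b := b')).1 h'
    refine (I.quot_eq (a := a * b) (b := a' * b')).2 ?_
    have : a * b - a' * b' = (a - a') * b + a' * (b - b') := by noncomm_ring
    rw [this]
    exact add_mem (I.mul_mem_right' _ h1) (I.mul_mem_left' _ h2)⟩

instance : Star I.Quot :=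
  ⟨Quotient.map star fun a a' h => by
    rw [← Quotient.eq_iff_equiv] at h ⊢
    have h1 := (I.quot_eq (a := a) (b := a')).1 h
    refine (I.quot_eq (a := star a) (b := star a')).2 ?_
    rw [← star_sub]
    exact I.star_mem h1⟩

theorem quot_mul (a b : A) : I.quot (a * b) = I.quot a * I.quot b := rfl

theorem quot_star (a : A) : I.quot (star a) = star (I.quot a) := rfl

/-- The estimate behind the `C⋆`-identity for quotients. -/
theorem exists_norm_sub_act_sq_le {E : Type v} [NormedAddCommGroup E] [NormedSpace ℂ E]
    [HilbertModule A E] (x : E) {ε : ℝ} (hε : 0 < ε) :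
    ∃ e ∈ I.toSubmodule, ‖x - act x e‖ ^ 2 ≤ ‖I.quot (ip x x)‖ + ε := by
  obtain ⟨c, hc, hcn⟩ := I.exists_lift (I.quot (ip x x)) (half_pos hε)
  have hj : c - ip x x ∈ I.toSubmodule := I.quot_eq.1 hc
  obtain ⟨e, he, hes, hcon, hje⟩ := I.exists_approx hj (half_pos hε)
  refine ⟨e, he, ?_⟩
  have hcon' : ∀ y : A, ‖y - y * e‖ ≤ ‖y‖ := fun y => by
    have := hcon (star y)
    rw [← norm_star, ← norm_star y]
    simpa [hes] using this
  have hsub : ∀ y z : E, ip (A := A) y (z - act z e) = ip y z - ip y z * e := fun y z => by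
    rw [← ip_act]
    exact map_sub (ipL A y) z (act z e)
  have hsub' : ∀ y z : E, ip (A := A) (z - act z e) y = ip z y - e * ip z y := fun y z => by
    rw [← star_ip, hsub, star_sub, star_mul, hes, star_ip]
  rw [norm_sq (A := A), hsub, hsub']
  set p : A := ip x x
  have key : p - e * p - (p - e * p) * e =
      ((c - e * c) - (c - e * c) * e) -
        (((c - p) - e * (c - p)) - ((c - p) - e * (c - p)) * e) := by noncomm_ring
  rw [key]
  calc _ ≤ _ := norm_sub_le _ _
    _ ≤ ‖c‖ + ε / 2 := add_le_add ((hcon' _).trans (hcon _)) ((hcon' _).trans hje)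
    _ ≤ _ := by linarith

instance : NonUnitalCStarAlgebra I.Quot :=
  { (inferInstance : NormedAddCommGroup I.Quot), (inferInstance : NormedSpace ℂ I.Quot),
    (inferInstance : CompleteSpace I.Quot) with
    mul := (· * ·)
    star := star
    left_distrib := by
      intro a b c
      obtain ⟨a, rfl⟩ := I.quot_surjective a
      obtain ⟨b, rfl⟩ := I.quot_surjective b
      obtain ⟨c, rfl⟩ := I.quot_surjective c
      change I.quot (a * (b + c)) = I.quot (a * b + a * c)
      rw [mul_add]
    right_distrib := by
      intro a b c
      obtain ⟨a, rfl⟩ := I.quot_surjective a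
      obtain ⟨b, rfl⟩ := I.quot_surjective b
      obtain ⟨c, rfl⟩ := I.quot_surjective c
      change I.quot ((a + b) * c) = I.quot (a * c + b * c)
      rw [add_mul]
    zero_mul := by
      intro a
      obtain ⟨a, rfl⟩ := I.quot_surjective a
      change I.quot (0 * a) = I.quot 0
      rw [zero_mul]
    mul_zero := by
      intro a
      obtain ⟨a, rfl⟩ := I.quot_surjective a
      change I.quot (a * 0) = I.quot 0
      rw [mul_zero]
    mul_assoc := by
      intro a b c
      obtain ⟨a, rfl⟩ := I.quot_surjective a
      obtain ⟨b, rfl⟩ := I.quot_surjective b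
      obtain ⟨c, rfl⟩ := I.quot_surjective c
      change I.quot (a * b * c) = I.quot (a * (b * c))
      rw [mul_assoc]
    norm_mul_le := by
      intro a b
      refine le_of_forall_pos_le_add fun δ hδ => ?_
      have hlim : Filter.Tendsto (fun ε : ℝ => (‖a‖ + ε) * (‖b‖ + ε)) (nhdsWithin 0 (Set.Ioi 0))
          (nhds (‖a‖ * ‖b‖)) := by
        have : Continuous fun ε : ℝ => (‖a‖ + ε) * (‖b‖ + ε) := by fun_prop
        simpa using (this.tendsto 0).mono_left nhdsWithin_le_nhds
      obtain ⟨ε, h1, hε⟩ := ((hlim.eventually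
        (gt_mem_nhds (lt_add_of_pos_right _ hδ))).and self_mem_nhdsWithin).exists
      obtain ⟨x, hx, hx'⟩ := I.exists_lift a hε
      obtain ⟨y, hy, hy'⟩ := I.exists_lift b hε
      have hxy : a * b = I.quot (x * y) := by rw [← hx, ← hy]; rfl
      have h2 : ‖a * b‖ ≤ ‖x‖ * ‖y‖ := by
        rw [hxy]; exact (I.norm_quot_le _).trans (norm_mul_le _ _)
      have h3 : ‖x‖ * ‖y‖ ≤ (‖a‖ + ε) * (‖b‖ + ε) := by gcongr
      exact (h2.trans h3).trans h1.le
    star_involutive := by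
      intro a
      obtain ⟨a, rfl⟩ := I.quot_surjective a
      change I.quot (star (star a)) = I.quot a
      rw [star_star]
    star_mul := by
      intro a b
      obtain ⟨a, rfl⟩ := I.quot_surjective a
      obtain ⟨b, rfl⟩ := I.quot_surjective b
      change I.quot (star (a * b)) = I.quot (star b * star a)
      rw [star_mul]
    star_add := by
      intro a b
      obtain ⟨a, rfl⟩ := I.quot_surjective a
      obtain ⟨b, rfl⟩ := I.quot_surjective b
      change I.quot (star (a + b)) = I.quot (star a + star b)
      rw [star_add]
    norm_mul_self_le := by
      intro a
      obtain ⟨a, rfl⟩ := I.quot_surjective a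
      change ‖I.quot a‖ * ‖I.quot a‖ ≤ ‖I.quot (star a * a)‖
      refine le_of_forall_pos_le_add fun ε hε => ?_
      let _ : HilbertModule A A := HilbertModule.self
      obtain ⟨e, he, h⟩ := I.exists_norm_sub_act_sq_le a hε
      have h1 : I.quot a = I.quot (a - a * e) :=
        I.quot_eq.2 (by rw [sub_sub_cancel]; exact I.mul_mem_left' _ he)
      have h2 : ‖I.quot a‖ ≤ ‖a - a * e‖ := by rw [h1]; exact I.norm_quot_le _
      calc ‖I.quot a‖ * ‖I.quot a‖ ≤ ‖a - a * e‖ * ‖a - a * e‖ := by gcongr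
        _ = ‖a - a * e‖ ^ 2 := (sq _).symm
        _ ≤ _ := h
    smul_assoc := by
      intro z a b
      obtain ⟨a, rfl⟩ := I.quot_surjective a
      obtain ⟨b, rfl⟩ := I.quot_surjective b
      change I.quot ((z • a) * b) = I.quot (z • (a * b))
      rw [smul_mul_assoc]
    smul_comm := by
      intro z a b
      obtain ⟨a, rfl⟩ := I.quot_surjective a
      obtain ⟨b, rfl⟩ := I.quot_surjective b
      change I.quot (z • (a * b)) = I.quot (a * (z • b))
      rw [mul_smul_comm]
    star_smul := by
      intro z a
      obtain ⟨a, rfl⟩ := I.quot_surjective a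
      change I.quot (star (z • a)) = I.quot (star z • star a)
      rw [star_smul] }

end ClosedIdeal

namespace ClosedIdeal

variable {A : Type u} [NonUnitalCStarAlgebra A]

/-- The intersection of two closed ideals. -/
def inter (I J : ClosedIdeal A) : ClosedIdeal A where
  toSubmodule := I.toSubmodule ⊓ J.toSubmodule
  mul_mem_left' a _ hb := ⟨I.mul_mem_left' a hb.1, J.mul_mem_left' a hb.2⟩
  mul_mem_right' b ha := ⟨I.mul_mem_right' b ha.1, J.mul_mem_right' b ha.2⟩
  isClosed' := I.isClosed'.inter J.isClosed'

end ClosedIdeal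

namespace HilbertModule

variable {A : Type u} {E : Type v} [NonUnitalCStarAlgebra A] [NormedAddCommGroup E]
  [NormedSpace ℂ E] [HilbertModule A E]

variable (E) in
/-- The quotient module `E_I = E / E·I`, with the quotient norm. -/
abbrev ModQuot (I : ClosedIdeal A) : Type v := E ⧸ mulIdeal E I

/-- The quotient map `E → E_I`. -/
abbrev modQuot (I : ClosedIdeal A) : E →ₗ[ℂ] ModQuot E I := (mulIdeal E I).mkQ

/-- The right action of `A / I` on `E_I`: `[x]·[a] = [x·a]`. -/
def quotAct (I : ClosedIdeal A) : ModQuot E I → I.Quot → ModQuot E I :=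
  Quotient.map₂ act fun x x' h a a' h' => by
    rw [← Quotient.eq_iff_equiv] at h h' ⊢
    have h1 : x - x' ∈ mulIdeal E I := (Submodule.Quotient.eq _).1 h
    have h2 : a - a' ∈ I.toSubmodule := (Submodule.Quotient.eq _).1 h'
    refine (Submodule.Quotient.eq _).2 ?_
    have h3 : act x a = act x' a + act (x - x') a := by rw [← add_act]; simp
    have h4 : act x' a = act x' a' + act x' (a - a') := by rw [← act_add]; simp
    have : act x a - act x' a' = act (x - x') a + act x' (a - a') := by rw [h3, h4]; abel
    rw [this]
    exact add_mem (act_mem_left h1 a) (act_mem_mulIdeal x' h2)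

/-- The inner product of `E_I`: `⟪[x], [y]⟫ = [⟪x, y⟫]`. -/
def quotIp (I : ClosedIdeal A) : ModQuot E I → ModQuot E I → I.Quot :=
  Quotient.map₂ ip fun x x' h y y' h' => by
    rw [← Quotient.eq_iff_equiv] at h h' ⊢
    have h1 : x - x' ∈ mulIdeal E I := (Submodule.Quotient.eq _).1 h
    have h2 : y - y' ∈ mulIdeal E I := (Submodule.Quotient.eq _).1 h'
    refine (Submodule.Quotient.eq _).2 ?_
    have h3 : ip (A := A) x y = ip x' y + ip (x - x') y := by rw [← add_ip]; simp
    have h4 : ip (A := A) x' y = ip x' y' + ip x' (y - y') := by rw [← ip_add]; simp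
    have : ip (A := A) x y - ip x' y' = ip (x - x') y + ip x' (y - y') := by rw [h3, h4]; abel
    rw [this]
    refine add_mem ?_ (ip_mem_right x' h2)
    rw [← star_ip]
    exact I.star_mem (ip_mem_right y h1)

instance quotModule (I : ClosedIdeal A) : HilbertModule I.Quot (ModQuot E I) where
  act := quotAct I
  ip := quotIp I
  add_act := by
    rintro ⟨x⟩ ⟨y⟩ ⟨a⟩
    exact congrArg (modQuot I) (add_act x y a)
  act_add := by
    rintro ⟨x⟩ ⟨a⟩ ⟨b⟩
    exact congrArg (modQuot I) (act_add x a b)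
  smul_act := by
    rintro z ⟨x⟩ ⟨a⟩
    exact congrArg (modQuot I) (smul_act z x a)
  act_smul := by
    rintro z ⟨x⟩ ⟨a⟩
    exact congrArg (modQuot I) (act_smul z x a)
  act_mul := by
    rintro ⟨x⟩ ⟨a⟩ ⟨b⟩
    exact congrArg (modQuot I) (act_mul x a b)
  ip_add := by
    rintro ⟨x⟩ ⟨y⟩ ⟨z⟩
    exact congrArg I.quot (ip_add x y z)
  ip_smul := by
    rintro z ⟨x⟩ ⟨y⟩
    exact congrArg I.quot (ip_smul z x y)
  star_ip := by
    rintro ⟨x⟩ ⟨y⟩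
    exact congrArg I.quot (star_ip x y)
  ip_nonneg := by
    rintro ⟨x⟩
    obtain ⟨b, hb⟩ := ip_nonneg (A := A) x
    exact ⟨I.quot b, congrArg I.quot hb⟩
  ip_act := by
    rintro ⟨x⟩ ⟨y⟩ ⟨a⟩
    exact congrArg I.quot (ip_act x y a)
  norm_sq := by
    intro q
    refine le_antisymm ?_ ?_
    · obtain ⟨x, rfl⟩ := (mulIdeal E I).mkQ_surjective q
      change ‖modQuot I x‖ ^ 2 ≤ ‖I.quot (ip x x)‖
      refine le_of_forall_pos_le_add fun ε hε => ?_
      obtain ⟨e, he, h⟩ := I.exists_norm_sub_act_sq_le x hε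
      have h1 : modQuot I x = modQuot I (x - act x e) :=
        (Submodule.Quotient.eq _).2 (by rw [sub_sub_cancel]; exact act_mem_mulIdeal x he)
      have h2 : ‖modQuot I x‖ ≤ ‖x - act x e‖ := by
        rw [h1]; exact Submodule.Quotient.norm_mk_le _ _
      exact (pow_le_pow_left₀ (norm_nonneg _) h2 2).trans h
    · have hlim : Filter.Tendsto (fun ε : ℝ => (‖q‖ + ε) ^ 2) (nhdsWithin 0 (Set.Ioi 0))
          (nhds (‖q‖ ^ 2)) := by
        have : Continuous fun ε : ℝ => (‖q‖ + ε) ^ 2 := by fun_prop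
        simpa using (this.tendsto 0).mono_left nhdsWithin_le_nhds
      refine ge_of_tendsto hlim (Filter.eventually_of_mem self_mem_nhdsWithin fun ε hε => ?_)
      obtain ⟨x, rfl, hx⟩ := Submodule.Quotient.norm_mk_lt q hε
      change ‖I.quot (ip x x)‖ ≤ _
      calc ‖I.quot (ip x x)‖ ≤ ‖ip (A := A) x x‖ := I.norm_quot_le _
        _ = ‖x‖ ^ 2 := (norm_sq x).symm
        _ ≤ _ := pow_le_pow_left₀ (norm_nonneg _) hx.le 2
  complete := by
    have : CompleteSpace E := complete A
    infer_instance

/-- The direct sum of a finite family of Hilbert modules over the direct sum of the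
`C⋆`-algebras, with componentwise operations (and the maximum norm). -/
instance piModule {ι : Type*} [Fintype ι] {B : ι → Type u} {Y : ι → Type v}
    [∀ i, NonUnitalCStarAlgebra (B i)] [∀ i, NormedAddCommGroup (Y i)]
    [∀ i, NormedSpace ℂ (Y i)] [∀ i, HilbertModule (B i) (Y i)] :
    HilbertModule (∀ i, B i) (∀ i, Y i) where
  act x a i := act (x i) (a i)
  ip x y i := ip (x i) (y i)
  add_act x y a := funext fun i => add_act _ _ _
  act_add x a b := funext fun i => act_add _ _ _
  smul_act z x a := funext fun i => smul_act _ _ _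
  act_smul z x a := funext fun i => act_smul _ _ _
  act_mul x a b := funext fun i => act_mul _ _ _
  ip_add x y z := funext fun i => ip_add _ _ _
  ip_smul z x y := funext fun i => ip_smul _ _ _
  star_ip x y := funext fun i => star_ip _ _
  ip_nonneg x := by
    choose b hb using fun i => ip_nonneg (A := B i) (x i)
    exact ⟨b, funext hb⟩
  ip_act x y a := funext fun i => ip_act _ _ _
  norm_sq x := by
    refine le_antisymm ?_ ((pi_norm_le_iff_of_nonneg (by positivity)).2 fun i => ?_)
    · refine (Real.le_sqrt (norm_nonneg _) (norm_nonneg _)).1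
        ((pi_norm_le_iff_of_nonneg (Real.sqrt_nonneg _)).2 fun i => Real.le_sqrt_of_sq_le ?_)
      rw [norm_sq (A := B i)]
      exact norm_le_pi_norm (fun i => ip (A := B i) (x i) (x i)) i
    · rw [← norm_sq (A := B i)]
      exact pow_le_pow_left₀ (norm_nonneg _) (norm_le_pi_norm x i) 2
  complete := by
    have : ∀ i, CompleteSpace (Y i) := fun i => complete (B i)
    infer_instance

end HilbertModule

end

open HilbertModule

noncomputable section

/-- A left action turning the Hilbert `B`-module `E` into an `A`-`B`-correspondence: a
`⋆`-homomorphism `φ` from `A` to the adjointable operators on `E`, that is, a homomorphism to the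
bounded operators such that `φ(a⋆)` is an adjoint of `φ(a)`. -/
structure LeftAction (A B : Type u) (E : Type v) [NonUnitalCStarAlgebra A]
    [NonUnitalCStarAlgebra B] [NormedAddCommGroup E] [NormedSpace ℂ E] [HilbertModule B E] where
  /-- The homomorphism to the bounded operators. -/
  toHom : A →ₙₐ[ℂ] (E →L[ℂ] E)
  adjoint : ∀ (a : A) (x y : E), ip (A := B) (toHom a x) y = ip x (toHom (star a) y)

/-- The correspondence is proper if `A` acts by compact operators. -/
def LeftAction.IsProper {A B : Type u} {E : Type v} [NonUnitalCStarAlgebra A]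
    [NonUnitalCStarAlgebra B] [NormedAddCommGroup E] [NormedSpace ℂ E] [HilbertModule B E]
    (φ : LeftAction A B E) : Prop :=
  ∀ a : A, φ.toHom a ∈ compacts B E

/-- `μ` induces an isomorphism of correspondences `X ⊗_B Y ≅ Z`, where `X` is an
`A`-`B`-correspondence and `Y`, `Z` are `B`-`C`- and `A`-`C`-correspondences. The tensor product
over `B` is the Hausdorff completion of the algebraic tensor product for the inner product
`⟪x ⊗ y, x' ⊗ y'⟫ = ⟪y, ⟪x, x'⟫ y'⟫`, and `Z` is complete; so the isomorphisms `X ⊗_B Y ≅ Z` are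
the maps induced by the linear maps on the algebraic tensor product that preserve the inner product,
have dense range and are compatible with both actions. -/
structure IsTensorIso {A B C : Type u} {X Y Z : Type v} [NonUnitalCStarAlgebra A]
    [NonUnitalCStarAlgebra B] [NonUnitalCStarAlgebra C]
    [NormedAddCommGroup X] [NormedSpace ℂ X] [HilbertModule B X]
    [NormedAddCommGroup Y] [NormedSpace ℂ Y] [HilbertModule C Y]
    [NormedAddCommGroup Z] [NormedSpace ℂ Z] [HilbertModule C Z]
    (φX : LeftAction A B X) (φY : LeftAction B C Y) (φZ : LeftAction A C Z)
    (μ : X ⊗[ℂ] Y →ₗ[ℂ] Z) : Prop where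
  ip_tmul : ∀ (x x' : X) (y y' : Y), ip (A := C) (μ (x ⊗ₜ y)) (μ (x' ⊗ₜ y')) =
    ip y (φY.toHom (ip x x') y')
  dense : DenseRange μ
  left : ∀ (a : A) (x : X) (y : Y), μ (φX.toHom a x ⊗ₜ y) = φZ.toHom a (μ (x ⊗ₜ y))
  right : ∀ (x : X) (y : Y) (c : C), μ (x ⊗ₜ act y c) = act (μ (x ⊗ₜ y)) c

/-- An `ℕⁿ`-product system over `A` on the Hilbert `A`-modules `X m`: left actions, a
correspondence isomorphism `X 0 ≅ A`, and associative multiplication isomorphisms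
`X m ⊗_A X k ≅ X (m + k)` for nonzero `m` and `k`. -/
structure ProductSystem (n : ℕ) (A : Type u) [NonUnitalCStarAlgebra A]
    (X : (Fin n → ℕ) → Type v) [∀ m, NormedAddCommGroup (X m)] [∀ m, NormedSpace ℂ (X m)]
    [∀ m, HilbertModule A (X m)] where
  /-- The left action of `A` on `X m`. -/
  left : ∀ m, LeftAction A A (X m)
  /-- The identification of `X 0` with `A`. -/
  zero : A ≃ₗ[ℂ] X 0
  ip_zero : ∀ a b : A, ip (zero a) (zero b) = star a * b
  zero_act : ∀ a b : A, act (zero a) b = zero (a * b)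
  left_zero : ∀ a b : A, (left 0).toHom a (zero b) = zero (a * b)
  /-- The multiplication maps, on the algebraic tensor products. -/
  mul : ∀ m k : Fin n → ℕ, m ≠ 0 → k ≠ 0 → (X m ⊗[ℂ] X k →ₗ[ℂ] X (m + k))
  isTensorIso : ∀ (m k : Fin n → ℕ) (hm : m ≠ 0) (hk : k ≠ 0),
    IsTensorIso (left m) (left k) (left (m + k)) (mul m k hm hk)
  assoc : ∀ (m k l : Fin n → ℕ) (hm : m ≠ 0) (hk : k ≠ 0) (hl : l ≠ 0)
    (hmk : m + k ≠ 0) (hkl : k + l ≠ 0) (x : X m) (y : X k) (z : X l),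
    cast (congrArg X (add_assoc m k l)) (mul (m + k) l hmk hl (mul m k hm hk (x ⊗ₜ y) ⊗ₜ z)) =
      mul m (k + l) hm hkl (x ⊗ₜ mul k l hk hl (y ⊗ₜ z))

namespace ProductSystem

variable {n : ℕ} {A : Type u} [NonUnitalCStarAlgebra A]
  {X : (Fin n → ℕ) → Type v} [∀ m, NormedAddCommGroup (X m)] [∀ m, NormedSpace ℂ (X m)]
  [∀ m, HilbertModule A (X m)]

/-- A product system is proper if all its correspondences are. -/
def IsProper (P : ProductSystem n A X) : Prop := ∀ m, (P.left m).IsProper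

/-- The ideal `(X m)⁻¹(I) = {a | a · X m ⊆ X m · I}`, as a set. -/
def preimage (P : ProductSystem n A X) (m : Fin n → ℕ) (I : ClosedIdeal A) : Set A :=
  {a | ∀ x : X m, (P.left m).toHom a x ∈ mulIdeal (X m) I}

/-- Invariant families: `K G = (X 1ᵢ)⁻¹(K G ∩ K (G ∪ {i}))` whenever `i ∉ G`. -/
def IsInvariantFamily (P : ProductSystem n A X) (K : Finset (Fin n) → ClosedIdeal A) : Prop :=
  ∀ (G : Finset (Fin n)) (i : Fin n), i ∉ G →
    ((K G).toSubmodule : Set A) = P.preimage (Pi.single i 1) ((K G).inter (K (insert i G)))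

end ProductSystem

/-- The support of a multi-index. -/
def multiSupp {n : ℕ} (m : Fin n → ℕ) : Finset (Fin n) := Finset.univ.filter fun i => m i ≠ 0

/-- The `C⋆`-algebra `A_K = ⨁_F A / K F`. -/
abbrev ExtAlg {n : ℕ} {A : Type u} [NonUnitalCStarAlgebra A]
    (K : Finset (Fin n) → ClosedIdeal A) : Type u :=
  ∀ F, (K F).Quot

/-- The Hilbert `A_K`-module `⨁_F X_{K F}`. -/
abbrev ExtMod {n : ℕ} {A : Type u} [NonUnitalCStarAlgebra A] (K : Finset (Fin n) → ClosedIdeal A)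
    (X : Type v) [NormedAddCommGroup X] [NormedSpace ℂ X] [HilbertModule A X] : Type v :=
  ∀ F, ModQuot X (K F)

end

/-! All operations are componentwise, so the real content is that they descend to the quotients.
Both formulas do so once `K (F \ supp m)` maps `X m` into `X m · K F` for every `m` and `F`
(`IsInvariantFamily.toHom_mem`). For `m = 1ᵢ` this is invariance at `G = F \ {i}`, because `F` is
`G` or `G ∪ {i}`. It passes to sums since `F \ supp (m + k) = (F \ supp k) \ supp m`: an element of
this ideal sends `X m` into `X m · K (F \ supp k)`, the balanced tensor product moves `K (F \ supp
k)` over to `X k`, and there it lands in `X k · K F`. Induction on `∑ i, m i` gives all `m`. The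
same set identity makes the multiplication associative and compatible with the left actions.

The analysis needed is modest. Membership in `E · I` is detected by `⟪z, z⟫ ∈ I`
(`mem_mulIdeal_iff`). Left actions are contractive (`LeftAction.norm_toHom_le`), so the
multiplication is bounded in each variable and preserves closed submodules. Compactness survives
quotients and finite direct sums, as rank-one operators do and the maps involved are bounded. Inner
products are inherited from `P`, and dense range follows by isolating one component at a time. -/

/-! ### Hilbert modules: submodules `E · I` and symmetric operators -/

namespace HilbertModule

variable {A : Type u} {E : Type v} [NonUnitalCStarAlgebra A] [NormedAddCommGroup E]
  [NormedSpace ℂ E] [HilbertModule A E]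

theorem ip_sub (x y z : E) : ip (A := A) x (y - z) = ip x y - ip x z :=
  map_sub (ipL A x) y z

theorem sub_ip (x y z : E) : ip (A := A) (x - y) z = ip x z - ip y z := by
  rw [← star_ip, ip_sub, star_sub, star_ip, star_ip]

theorem eq_zero_of_ip_self {x : E} (h : ip (A := A) x x = 0) : x = 0 := by
  have := norm_sq (A := A) x
  rw [h, norm_zero] at this
  exact norm_eq_zero.1 (pow_eq_zero_iff two_ne_zero |>.1 this)

/-- Approximate units of `I` supply `e ∈ I` with `z · e` arbitrarily close to `z`, because the class
of `⟪z, z⟫` in `A / I` vanishes. -/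
theorem mem_mulIdeal_of_ip_self {I : ClosedIdeal A} {z : E} (h : ip (A := A) z z ∈ I.toSubmodule) :
    z ∈ mulIdeal E I := by
  refine (isClosed_mulIdeal I).closure_subset_iff.2 subset_rfl
    (Metric.mem_closure_iff.2 fun ε hε => ?_)
  -- The estimate bounds the squared distance; `ε / 2` leaves room for the strict inequality.
  obtain ⟨e, he, hz⟩ := I.exists_norm_sub_act_sq_le z (show 0 < (ε / 2) ^ 2 by positivity)
  refine ⟨act z e, act_mem_mulIdeal z he, ?_⟩
  have h0 : I.quot (ip z z) = 0 := (Submodule.Quotient.mk_eq_zero _).2 h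
  rw [h0, norm_zero, zero_add] at hz
  rw [dist_eq_norm]
  have := le_of_sq_le_sq hz (half_pos hε).le
  linarith

theorem mem_mulIdeal_iff {I : ClosedIdeal A} {z : E} :
    z ∈ mulIdeal E I ↔ ip (A := A) z z ∈ I.toSubmodule :=
  ⟨ip_mem_right z, mem_mulIdeal_of_ip_self⟩

theorem mulIdeal_mono {I J : ClosedIdeal A} (h : I.toSubmodule ≤ J.toSubmodule) :
    mulIdeal E I ≤ mulIdeal E J :=
  fun _ hz => mem_mulIdeal_iff.2 (h (mem_mulIdeal_iff.1 hz))

/-- Cauchy-Schwarz applied to `⟪T x, T x⟫ = ⟪x, T² x⟫`. This replaces the `C⋆`-identity, since `E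
→L[ℂ] E` also contains non-adjointable operators. -/
theorem norm_sq_le_of_symmetric {T : E →L[ℂ] E}
    (hT : ∀ x y, ip (A := A) (T x) y = ip x (T y)) : ‖T‖ ^ 2 ≤ ‖T ^ 2‖ := by
  refine (Real.le_sqrt (norm_nonneg _) (norm_nonneg _)).1
    (T.opNorm_le_bound (Real.sqrt_nonneg _) fun x => le_of_sq_le_sq ?_ (by positivity))
  rw [mul_pow, Real.sq_sqrt (norm_nonneg _), norm_sq (A := A), hT]
  calc ‖ip (A := A) x (T (T x))‖ ≤ ‖x‖ * ‖T (T x)‖ := norm_ip_le A _ _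
    _ ≤ ‖x‖ * (‖T ^ 2‖ * ‖x‖) := by gcongr; exact (T ^ 2).le_opNorm x
    _ = ‖T ^ 2‖ * ‖x‖ ^ 2 := by ring

theorem norm_pow_two_pow_le_of_symmetric {T : E →L[ℂ] E}
    (hT : ∀ x y, ip (A := A) (T x) y = ip x (T y)) (n : ℕ) : ‖T‖ ^ 2 ^ n ≤ ‖T ^ 2 ^ n‖ := by
  induction n with
  | zero => simp
  | succ n ih =>
    have hpow : ∀ k x y, ip (A := A) ((T ^ k) x) y = ip x ((T ^ k) y) := by
      intro k
      induction k with
      | zero => intro x y; rfl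
      | succ k ihk =>
        intro x y
        rw [pow_succ, mul_apply_eq_comp, ihk, hT, ← mul_apply_eq_comp,
          ← pow_succ', pow_succ]
    calc ‖T‖ ^ 2 ^ (n + 1) = (‖T‖ ^ 2 ^ n) ^ 2 := by rw [pow_succ, pow_mul]
      _ ≤ ‖T ^ 2 ^ n‖ ^ 2 := by gcongr
      _ ≤ ‖(T ^ 2 ^ n) ^ 2‖ := norm_sq_le_of_symmetric (hpow _)
      _ = ‖T ^ 2 ^ (n + 1)‖ := by rw [← pow_mul, ← pow_succ]

/-- Gelfand's formula along the exponents `2 ^ n`, where every term is at least `‖T‖`. -/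
theorem nnnorm_le_spectralRadius_of_symmetric {T : E →L[ℂ] E}
    (hT : ∀ x y, ip (A := A) (T x) y = ip x (T y)) : (‖T‖₊ : ENNReal) ≤ spectralRadius ℂ T := by
  have : CompleteSpace E := complete A
  refine ge_of_tendsto' ((spectrum.pow_nnnorm_pow_one_div_tendsto_nhds_spectralRadius T).comp
    (tendsto_pow_atTop_atTop_of_one_lt one_lt_two)) fun n => ?_
  have h : (‖T‖₊ : ENNReal) ^ 2 ^ n ≤ ‖T ^ 2 ^ n‖₊ := by
    exact_mod_cast norm_pow_two_pow_le_of_symmetric hT n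
  calc (‖T‖₊ : ENNReal) = ((‖T‖₊ : ENNReal) ^ 2 ^ n) ^ (1 / ((2 ^ n : ℕ) : ℝ)) := by
        rw [← ENNReal.rpow_natCast, ← ENNReal.rpow_mul]
        simp
    _ ≤ _ := ENNReal.rpow_le_rpow h (by positivity)

end HilbertModule

/-! ### Left actions are contractive -/

namespace LeftAction

variable {A B : Type u} {E : Type v} [NonUnitalCStarAlgebra A] [NonUnitalCStarAlgebra B]
  [NormedAddCommGroup E] [NormedSpace ℂ E] [HilbertModule B E] (φ : LeftAction A B E)

/-- The image of a self-adjoint element is symmetric, so its norm is at most its spectral radius,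
and homomorphisms shrink spectra. -/
theorem norm_toHom_le_of_star_eq {a : A} (ha : star a = a) : ‖φ.toHom a‖ ≤ ‖a‖ := by
  have hsym : ∀ x y, ip (A := B) (φ.toHom a x) y = ip x (φ.toHom a y) := fun x y => by
    rw [φ.adjoint, ha]
  -- Spectra need units, so `φ` is extended to the unitization, into which `A` embeds isometrically.
  have h1 : spectrum ℂ (φ.toHom a) ⊆ spectrum ℂ (a : Unitization ℂ A) := by
    have := AlgHom.spectrum_apply_subset (Unitization.lift φ.toHom) (a : Unitization ℂ A)
    rwa [show Unitization.lift φ.toHom (a : Unitization ℂ A) = φ.toHom a by simp] at this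
  have h2 : spectralRadius ℂ (φ.toHom a) ≤ spectralRadius ℂ (a : Unitization ℂ A) :=
    biSup_mono h1
  have h3 := (nnnorm_le_spectralRadius_of_symmetric hsym).trans
    (h2.trans (spectrum.spectralRadius_le_nnnorm _))
  have h4 : ‖φ.toHom a‖ ≤ ‖(a : Unitization ℂ A)‖ := by exact_mod_cast h3
  rwa [Unitization.norm_inr] at h4

/-- Reduces to the self-adjoint element `a⋆ a` through `⟪φ(a) x, φ(a) x⟫ = ⟪x, φ(a⋆ a) x⟫`. -/
theorem norm_toHom_le (a : A) : ‖φ.toHom a‖ ≤ ‖a‖ := by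
  refine (φ.toHom a).opNorm_le_bound (norm_nonneg _) fun x => le_of_sq_le_sq ?_ (by positivity)
  rw [norm_sq (A := B), φ.adjoint, ← mul_apply_eq_comp, ← map_mul]
  have h := φ.norm_toHom_le_of_star_eq (a := star a * a) (by simp)
  rw [CStarRing.norm_star_mul_self] at h
  calc _ ≤ ‖x‖ * ‖φ.toHom (star a * a) x‖ := norm_ip_le B _ _
    _ ≤ ‖x‖ * (‖a‖ * ‖a‖ * ‖x‖) := by
        gcongr; exact (φ.toHom (star a * a)).le_of_opNorm_le h x
    _ = (‖a‖ * ‖x‖) ^ 2 := by ring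

theorem ip_toHom (a : A) (x y : E) :
    ip (A := B) x (φ.toHom a y) = ip (φ.toHom (star a) x) y := by
  rw [φ.adjoint, star_star]

theorem toHom_mem_mulIdeal (a : A) {J : ClosedIdeal B} {z : E} (hz : z ∈ mulIdeal E J) :
    φ.toHom a z ∈ mulIdeal E J := by
  rw [mem_mulIdeal_iff, ip_toHom]
  exact ip_mem_right _ hz

end LeftAction

/-! ### Tensor multiplication and ideal submodules -/

namespace IsTensorIso

variable {A B C : Type u} {X Y Z : Type v} [NonUnitalCStarAlgebra A]
  [NonUnitalCStarAlgebra B] [NonUnitalCStarAlgebra C]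
  [NormedAddCommGroup X] [NormedSpace ℂ X] [HilbertModule B X]
  [NormedAddCommGroup Y] [NormedSpace ℂ Y] [HilbertModule C Y]
  [NormedAddCommGroup Z] [NormedSpace ℂ Z] [HilbertModule C Z]
  {φX : LeftAction A B X} {φY : LeftAction B C Y} {φZ : LeftAction A C Z}
  {μ : X ⊗[ℂ] Y →ₗ[ℂ] Z}

theorem norm_tmul_le (h : IsTensorIso φX φY φZ μ) (x : X) (y : Y) :
    ‖μ (x ⊗ₜ y)‖ ≤ ‖x‖ * ‖y‖ := by
  refine le_of_sq_le_sq ?_ (by positivity)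
  rw [norm_sq (A := C), h.ip_tmul]
  calc _ ≤ ‖y‖ * ‖φY.toHom (ip x x) y‖ := norm_ip_le C _ _
    _ ≤ ‖y‖ * (‖ip (A := B) x x‖ * ‖y‖) := by
        gcongr; exact (φY.toHom _).le_of_opNorm_le (φY.norm_toHom_le _) y
    _ = (‖x‖ * ‖y‖) ^ 2 := by rw [← norm_sq]; ring

/-- Multiplication on the right by `y`, as a bounded operator. -/
def tmulRight (h : IsTensorIso φX φY φZ μ) (y : Y) : X →L[ℂ] Z :=
  LinearMap.mkContinuous
    { toFun := fun x => μ (x ⊗ₜ y)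
      map_add' := fun x x' => by rw [TensorProduct.add_tmul, map_add]
      map_smul' := fun c x => by rw [← TensorProduct.smul_tmul', map_smul, RingHom.id_apply] } ‖y‖
    (fun x => by rw [mul_comm]; exact h.norm_tmul_le x y)

/-- Multiplication on the left by `x`, as a bounded operator. -/
def tmulLeft (h : IsTensorIso φX φY φZ μ) (x : X) : Y →L[ℂ] Z :=
  LinearMap.mkContinuous
    { toFun := fun y => μ (x ⊗ₜ y)
      map_add' := fun y y' => by rw [TensorProduct.tmul_add, map_add]
      map_smul' := fun c y => by rw [TensorProduct.tmul_smul, map_smul, RingHom.id_apply] } ‖x‖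
    (fun y => h.norm_tmul_le x y)

/-- Balancedness is forced by the inner product: in the square of the difference all four terms
equal `⟪y, b⋆ ⟪x, x⟫ b y⟫` up to sign. -/
theorem balanced (h : IsTensorIso φX φY φZ μ) (x : X) (b : B) (y : Y) :
    μ (act x b ⊗ₜ y) = μ (x ⊗ₜ φY.toHom b y) := by
  refine sub_eq_zero.1 (eq_zero_of_ip_self (A := C) ?_)
  simp only [ip_sub, sub_ip, h.ip_tmul, ip_act, act_ip, map_mul, mul_apply_eq_comp,
    φY.adjoint]
  abel

theorem mem_mulIdeal_right (h : IsTensorIso φX φY φZ μ) {J : ClosedIdeal C} (x : X) {y : Y}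
    (hy : y ∈ mulIdeal Y J) : μ (x ⊗ₜ y) ∈ mulIdeal Z J :=
  mulIdeal_induction (h.tmulLeft x) (isClosed_mulIdeal J) (fun y c hc => by
    change μ (x ⊗ₜ act y c) ∈ _
    rw [h.right]
    exact act_mem_mulIdeal _ hc) hy

/-- On generators, `(x · b) ⊗ y = x ⊗ b y` with `b y ∈ Y · J`; boundedness in `x` extends this to
the closure. -/
theorem mem_mulIdeal_left (h : IsTensorIso φX φY φZ μ) {I : ClosedIdeal B} {J : ClosedIdeal C}
    (hIJ : ∀ b ∈ I.toSubmodule, ∀ y, φY.toHom b y ∈ mulIdeal Y J) {x : X}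
    (hx : x ∈ mulIdeal X I) (y : Y) : μ (x ⊗ₜ y) ∈ mulIdeal Z J :=
  mulIdeal_induction (h.tmulRight y) (isClosed_mulIdeal J) (fun x b hb => by
    change μ (act x b ⊗ₜ y) ∈ _
    rw [h.balanced]
    exact h.mem_mulIdeal_right x (hIJ b hb y)) hx

end IsTensorIso

/-! ### Supports and the propagation of invariance to all degrees -/

theorem multiSupp_zero {n : ℕ} : multiSupp (0 : Fin n → ℕ) = ∅ := by
  simp [multiSupp]

theorem multiSupp_single {n : ℕ} (i : Fin n) : multiSupp (Pi.single i 1 : Fin n → ℕ) = {i} := by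
  ext j
  simp [multiSupp, Pi.single_apply]

/-- No cancellation occurs in `ℕ`, so supports of sums are unions. -/
theorem sdiff_multiSupp_add {n : ℕ} (F : Finset (Fin n)) (m k : Fin n → ℕ) :
    F \ multiSupp (m + k) = (F \ multiSupp k) \ multiSupp m := by
  ext j
  simp only [multiSupp, Finset.mem_sdiff, Finset.mem_filter, Finset.mem_univ, true_and,
    Pi.add_apply]
  grind

namespace ProductSystem

variable {n : ℕ} {A : Type u} [NonUnitalCStarAlgebra A]
  {X : (Fin n → ℕ) → Type v} [∀ m, NormedAddCommGroup (X m)] [∀ m, NormedSpace ℂ (X m)]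
  [∀ m, HilbertModule A (X m)] {P : ProductSystem n A X} {K : Finset (Fin n) → ClosedIdeal A}

/-- If `a⋆ a ∈ I` then `a ∈ I`, by the `C⋆`-identity in `A / I`. -/
theorem zero_mem_mulIdeal_iff (P : ProductSystem n A X) {I : ClosedIdeal A} {a : A} :
    P.zero a ∈ mulIdeal (X 0) I ↔ a ∈ I.toSubmodule := by
  rw [mem_mulIdeal_iff, P.ip_zero]
  refine ⟨fun h => ?_, fun h => I.mul_mem_left' _ h⟩
  have h0 : star (I.quot a) * I.quot a = 0 := (Submodule.Quotient.mk_eq_zero _).2 h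
  exact (Submodule.Quotient.mk_eq_zero _).1 (CStarRing.star_mul_self_eq_zero_iff _ |>.1 h0)

/-- If `F` contains `i` then `K (F \ {i})` maps `X 1ᵢ` into `X 1ᵢ · K F`; otherwise `K F` does. -/
theorem IsInvariantFamily.toHom_single_mem (hK : P.IsInvariantFamily K) {i : Fin n}
    {F : Finset (Fin n)} {a : A} (ha : a ∈ (K (F \ {i})).toSubmodule) (x : X (Pi.single i 1)) :
    (P.left _).toHom a x ∈ mulIdeal (X (Pi.single i 1)) (K F) := by
  have hi : i ∉ F \ {i} := by simp
  have h : (P.left _).toHom a x ∈ mulIdeal _ ((K (F \ {i})).inter (K (insert i (F \ {i})))) :=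
    (hK _ i hi).subset ha x
  by_cases hF : i ∈ F
  · have hins : insert i (F \ {i}) = F := by
      rw [Finset.sdiff_singleton_eq_erase, Finset.insert_erase hF]
    rw [hins] at h
    exact mulIdeal_mono inf_le_right h
  · rw [Finset.sdiff_singleton_eq_erase, Finset.erase_eq_of_notMem hF] at h
    exact mulIdeal_mono inf_le_left h

/-- The inductive step. By density and left linearity it suffices to treat `(a x) ⊗ y`, where `a x`
lies in `X m · K (F \ supp k)` and `K (F \ supp k)` sends `X k` into `X k · K F`. -/
theorem toHom_add_mem_mulIdeal {m k : Fin n → ℕ}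
    (hm0 : m ≠ 0) (hk0 : k ≠ 0)
    (hm : ∀ (F : Finset (Fin n)), ∀ a ∈ (K (F \ multiSupp m)).toSubmodule, ∀ x : X m,
      (P.left m).toHom a x ∈ mulIdeal (X m) (K F))
    (hk : ∀ (F : Finset (Fin n)), ∀ a ∈ (K (F \ multiSupp k)).toSubmodule, ∀ x : X k,
      (P.left k).toHom a x ∈ mulIdeal (X k) (K F))
    (F : Finset (Fin n)) (a : A) (ha : a ∈ (K (F \ multiSupp (m + k))).toSubmodule)
    (z : X (m + k)) : (P.left (m + k)).toHom a z ∈ mulIdeal (X (m + k)) (K F) := by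
  have hμ := P.isTensorIso m k hm0 hk0
  rw [sdiff_multiSupp_add] at ha
  refine hμ.dense.induction_on
    (p := fun z => (P.left (m + k)).toHom a z ∈ mulIdeal (X (m + k)) (K F)) z
    ((isClosed_mulIdeal (K F)).preimage ((P.left (m + k)).toHom a).continuous) fun t => ?_
  induction t with
  | zero => simp
  | add s t hs ht => rw [map_add, map_add]; exact add_mem hs ht
  | tmul x y =>
    rw [← hμ.left]
    exact hμ.mem_mulIdeal_left (hk F) (hm _ a ha x) y

/-- The well-definedness statement behind both the left actions and the multiplication of the new
system. -/
theorem IsInvariantFamily.toHom_mem (hK : P.IsInvariantFamily K) (m : Fin n → ℕ)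
    (F : Finset (Fin n)) (a : A) (ha : a ∈ (K (F \ multiSupp m)).toSubmodule) (x : X m) :
    (P.left m).toHom a x ∈ mulIdeal (X m) (K F) := by
  induction hN : ∑ i, m i generalizing m F a with
  | zero =>
    obtain rfl : m = 0 := by
      funext i
      exact Finset.sum_eq_zero_iff.1 hN i (Finset.mem_univ i)
    obtain ⟨b, rfl⟩ := P.zero.surjective x
    rw [multiSupp_zero, Finset.sdiff_empty] at ha
    rw [P.left_zero, zero_mem_mulIdeal_iff]
    exact (K F).mul_mem_right' b ha
  | succ N ih =>
    obtain ⟨i, hi⟩ : ∃ i, m i ≠ 0 := by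
      by_contra! h
      simp [h] at hN
    obtain ⟨k, rfl⟩ : ∃ k : Fin n → ℕ, m = Pi.single i 1 + k := by
      have hle : (Pi.single i 1 : Fin n → ℕ) ≤ m := fun j => ?_
      · exact ⟨m - Pi.single i 1, (add_tsub_cancel_of_le hle).symm⟩
      by_cases hj : j = i
      · subst hj; simp; omega
      · simp [hj]
    have hs : ∀ (F : Finset (Fin n)), ∀ a ∈ (K (F \ multiSupp (Pi.single i 1))).toSubmodule,
        ∀ x : X (Pi.single i 1), (P.left _).toHom a x ∈ mulIdeal (X (Pi.single i 1)) (K F) :=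
      fun F a ha x => hK.toHom_single_mem (by rwa [multiSupp_single] at ha) x
    by_cases hk : k = 0
    · subst hk
      -- Multiplication exists only in nonzero degrees, so `k = 0` is separate; `m` is generalized
      -- because `X (1ᵢ + 0)` and `X 1ᵢ` are different types.
      have aux : ∀ m : Fin n → ℕ, m = Pi.single i 1 → ∀ a ∈ (K (F \ multiSupp m)).toSubmodule,
          ∀ x : X m, (P.left m).toHom a x ∈ mulIdeal (X m) (K F) := by
        rintro _ rfl
        exact hs F
      exact aux _ (add_zero _) a ha x
    · refine toHom_add_mem_mulIdeal (fun h => ?_) hk hs (fun F a ha x => ih k F a ha x ?_) F a ha x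
      · simpa using congrFun h i
      · simp only [Pi.add_apply, Finset.sum_add_distrib, Finset.sum_pi_single'] at hN
        simp at hN
        omega

end ProductSystem

/-! ### Left actions on quotient modules -/

namespace LeftAction

section Quotient

variable {A B : Type u} {E : Type v} [NonUnitalCStarAlgebra A] [NonUnitalCStarAlgebra B]
  [NormedAddCommGroup E] [NormedSpace ℂ E] [HilbertModule B E] (φ : LeftAction A B E)
  {I : ClosedIdeal A} {J : ClosedIdeal B}
  (h : ∀ a ∈ I.toSubmodule, ∀ x, φ.toHom a x ∈ mulIdeal E J)

/-- The operator induced by `φ a` on the quotient `E / E·J`. -/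
noncomputable def quotOp (J : ClosedIdeal B) : A →ₗ[ℂ] (ModQuot E J →L[ℂ] ModQuot E J) where
  toFun a := (mulIdeal E J).liftQL ((mulIdeal E J).mkQL ∘L φ.toHom a) fun _ hz =>
    (Submodule.Quotient.mk_eq_zero _).2 (φ.toHom_mem_mulIdeal a hz)
  map_add' a b := by
    ext q
    obtain ⟨x, rfl⟩ := (mulIdeal E J).mkQ_surjective q
    exact congrArg (modQuot J) (by rw [map_add]; rfl : φ.toHom (a + b) x = _)
  map_smul' c a := by
    ext q
    obtain ⟨x, rfl⟩ := (mulIdeal E J).mkQ_surjective q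
    exact congrArg (modQuot J) (by rw [map_smul]; rfl : φ.toHom (c • a) x = _)

/-- The induced left action of `A / I` on `E / E·J`, if `I` maps `E` into `E·J`. -/
noncomputable def quotient : LeftAction I.Quot J.Quot (ModQuot E J) where
  toHom :=
    { I.toSubmodule.liftQ (φ.quotOp J) fun a ha => by
        ext q
        obtain ⟨x, rfl⟩ := (mulIdeal E J).mkQ_surjective q
        exact (Submodule.Quotient.mk_eq_zero _).2 (h a ha x) with
      map_zero' := map_zero _
      map_mul' := by
        intro p q
        obtain ⟨a, rfl⟩ := I.quot_surjective p
        obtain ⟨b, rfl⟩ := I.quot_surjective q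
        ext q
        obtain ⟨x, rfl⟩ := (mulIdeal E J).mkQ_surjective q
        exact congrArg (modQuot J) (by rw [map_mul]; rfl : φ.toHom (a * b) x = _) }
  adjoint := by
    intro p x y
    obtain ⟨a, rfl⟩ := I.quot_surjective p
    obtain ⟨x, rfl⟩ := (mulIdeal E J).mkQ_surjective x
    obtain ⟨y, rfl⟩ := (mulIdeal E J).mkQ_surjective y
    exact congrArg J.quot (φ.adjoint a x y)

theorem quotient_toHom (a : A) (x : E) :
    (φ.quotient h).toHom (I.quot a) (modQuot J x) = modQuot J (φ.toHom a x) := rfl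

end Quotient

end LeftAction

/-! ### Compact operators on quotients and direct sums -/

namespace HilbertModule

section RankOne

variable {A : Type u} {E : Type v} [NonUnitalCStarAlgebra A] [NormedAddCommGroup E]
  [NormedSpace ℂ E] [HilbertModule A E]

variable (A) in
/-- The rank-one operator `z ↦ x · ⟪y, z⟫`. -/
noncomputable def rankOne (x y : E) : E →L[ℂ] E :=
  LinearMap.mkContinuous
    { toFun := fun z => act x (ip (A := A) y z)
      map_add' := fun z w => by rw [ip_add, act_add]
      map_smul' := fun c z => by rw [ip_smul, act_smul, RingHom.id_apply] }
    (‖x‖ * ‖y‖) fun z => by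
      rw [mul_assoc]
      exact (norm_act_le x _).trans
        (mul_le_mul_of_nonneg_left (norm_ip_le A y z) (norm_nonneg x))

theorem rankOne_apply (x y z : E) : rankOne A x y z = act x (ip (A := A) y z) := rfl

end RankOne

theorem opNorm_le_of_comp_modQuot {A : Type u} {E : Type v} [NonUnitalCStarAlgebra A]
    [NormedAddCommGroup E] [NormedSpace ℂ E] [HilbertModule A E] {I : ClosedIdeal A}
    {S : ModQuot E I →L[ℂ] ModQuot E I} {T : E →L[ℂ] E}
    (h : ∀ x, S (modQuot I x) = modQuot I (T x)) : ‖S‖ ≤ ‖T‖ := by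
  refine S.opNorm_le_bound (norm_nonneg _) fun q => le_of_forall_pos_le_add fun ε hε => ?_
  -- The lift's excess norm is scaled so that `T` enlarges it by at most `ε`; the `+ 1` covers `T =
  -- 0`.
  have hδ : 0 < ε / (‖T‖ + 1) := by positivity
  obtain ⟨x, rfl, hx⟩ := Submodule.Quotient.norm_mk_lt q hδ
  calc ‖S (modQuot I x)‖ ≤ ‖T x‖ := by rw [h]; exact Submodule.Quotient.norm_mk_le _ _
    _ ≤ ‖T‖ * ‖x‖ := T.le_opNorm x
    _ ≤ ‖T‖ * (‖modQuot I x‖ + ε / (‖T‖ + 1)) := by gcongr; exact hx.le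
    _ = ‖T‖ * ‖modQuot I x‖ + ‖T‖ / (‖T‖ + 1) * ε := by ring
    _ ≤ ‖T‖ * ‖modQuot I x‖ + 1 * ε := by
        gcongr
        exact (div_le_one (by positivity)).2 (by linarith)
    _ = _ := by rw [one_mul]; rfl

/-- An operator on the quotient module that is induced by a compact operator is compact. -/
theorem mem_compacts_of_comp_modQuot {A : Type u} {E : Type v} [NonUnitalCStarAlgebra A]
    [NormedAddCommGroup E] [NormedSpace ℂ E] [HilbertModule A E] {I : ClosedIdeal A}
    {S : ModQuot E I →L[ℂ] ModQuot E I} {T : E →L[ℂ] E} (hT : T ∈ compacts A E)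
    (h : ∀ x, S (modQuot I x) = modQuot I (T x)) : S ∈ compacts I.Quot (ModQuot E I) := by
  -- Finite-rank approximants of `T` descend to the quotient, and the norm bound for induced
  -- operators keeps them close to `S`.
  have hspan : ∀ R ∈ Submodule.span ℂ {T : E →L[ℂ] E | IsRankOne A T},
      ∃ R' ∈ Submodule.span ℂ {T : ModQuot E I →L[ℂ] ModQuot E I | IsRankOne I.Quot T},
        ∀ x, R' (modQuot I x) = modQuot I (R x) := by
    intro R hR
    induction hR using Submodule.span_induction with
    | mem R hR =>
      obtain ⟨x, y, hxy⟩ := hR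
      refine ⟨rankOne I.Quot (modQuot I x) (modQuot I y), Submodule.subset_span
        ⟨modQuot I x, modQuot I y, rankOne_apply _ _⟩, fun z => ?_⟩
      rw [hxy]
      rfl
    | zero => exact ⟨0, zero_mem _, fun x => rfl⟩
    | add R₁ R₂ _ _ h₁ h₂ =>
      obtain ⟨S₁, hS₁, h₁⟩ := h₁
      obtain ⟨S₂, hS₂, h₂⟩ := h₂
      exact ⟨S₁ + S₂, add_mem hS₁ hS₂, fun x => by
        simp only [add_apply, h₁, h₂, map_add]⟩
    | smul c R _ h₁ =>
      obtain ⟨S₁, hS₁, h₁⟩ := h₁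
      exact ⟨c • S₁, Submodule.smul_mem _ c hS₁, fun x => by
        simp only [smul_apply, h₁, map_smul]⟩
  refine Metric.mem_closure_iff.2 fun ε hε => ?_
  obtain ⟨R, hR, hTR⟩ := Metric.mem_closure_iff.1 hT ε hε
  obtain ⟨R', hR', hRR⟩ := hspan R hR
  refine ⟨R', hR', ?_⟩
  rw [dist_eq_norm] at hTR ⊢
  refine (opNorm_le_of_comp_modQuot (T := T - R) fun x => ?_).trans_lt hTR
  simp only [sub_apply, h, hRR, map_sub]

/-- Compact operators on the summands are compact on the direct sum. -/
theorem single_comp_proj_mem_compacts {ι : Type*} [Fintype ι] [DecidableEq ι] {B : ι → Type u}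
    {Y : ι → Type v} [∀ i, NonUnitalCStarAlgebra (B i)] [∀ i, NormedAddCommGroup (Y i)]
    [∀ i, NormedSpace ℂ (Y i)] [∀ i, HilbertModule (B i) (Y i)] {i : ι} {T : Y i →L[ℂ] Y i}
    (hT : T ∈ compacts (B i) (Y i)) :
    ContinuousLinearMap.single ℂ Y i ∘L T ∘L ContinuousLinearMap.proj i ∈
      compacts (∀ i, B i) (∀ i, Y i) := by
  -- Corner embedding is bounded and linear, so only rank-one operators need checking.
  let L : (Y i →L[ℂ] Y i) →L[ℂ] ((∀ i, Y i) →L[ℂ] (∀ i, Y i)) :=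
    (ContinuousLinearMap.compL ℂ _ _ _ (ContinuousLinearMap.single ℂ Y i)) ∘L
      ((ContinuousLinearMap.compL ℂ _ _ _).flip (ContinuousLinearMap.proj i))
  have hle : compacts (B i) (Y i) ≤ (compacts (∀ i, B i) (∀ i, Y i)).comap L.toLinearMap := by
    refine Submodule.topologicalClosure_minimal _ (Submodule.span_le.2 ?_)
      ((Submodule.isClosed_topologicalClosure _).preimage L.continuous)
    rintro R ⟨x, y, hxy⟩
    refine Submodule.le_topologicalClosure _ (Submodule.subset_span
      ⟨Pi.single i x, Pi.single i y, fun z => funext fun j => ?_⟩)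
    change (Pi.single i (R (z i)) : ∀ i, Y i) j = act (Pi.single i x j : Y j)
      (ip (A := B j) (Pi.single i y j : Y j) (z j))
    by_cases hj : j = i
    · subst hj
      simp [hxy]
    · rw [Pi.single_eq_of_ne hj, Pi.single_eq_of_ne hj]
      exact (map_zero (AddMonoidHom.mk' (fun w : Y j => act w _) fun x y => add_act x y _)).symm
  exact hle hT

end HilbertModule

/-! ### Properness and direct sums of left actions -/

namespace LeftAction

theorem quotient_isProper {A B : Type u} {E : Type v} [NonUnitalCStarAlgebra A]
    [NonUnitalCStarAlgebra B] [NormedAddCommGroup E] [NormedSpace ℂ E] [HilbertModule B E]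
    {φ : LeftAction A B E} (hφ : φ.IsProper) {I : ClosedIdeal A} {J : ClosedIdeal B}
    (h : ∀ a ∈ I.toSubmodule, ∀ x, φ.toHom a x ∈ mulIdeal E J) : (φ.quotient h).IsProper := by
  intro q
  obtain ⟨a, rfl⟩ := I.quot_surjective q
  exact mem_compacts_of_comp_modQuot (hφ a) (φ.quotient_toHom h a)

section Pi

variable {ι κ : Type} [Fintype ι] [Fintype κ] {A : κ → Type u} {B : ι → Type u} {Y : ι → Type v}
  [∀ i, NonUnitalCStarAlgebra (A i)] [∀ i, NonUnitalCStarAlgebra (B i)]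
  [∀ i, NormedAddCommGroup (Y i)] [∀ i, NormedSpace ℂ (Y i)] [∀ i, HilbertModule (B i) (Y i)]
  {σ : ι → κ}

/-- The direct sum of left actions, where the `i`-th summand is acted on through the `σ i`-th
summand of the algebra. -/
noncomputable def pi (φ : ∀ i, LeftAction (A (σ i)) (B i) (Y i)) :
    LeftAction (∀ i, A i) (∀ i, B i) (∀ i, Y i) where
  toHom :=
    { toFun := fun a => ContinuousLinearMap.pi fun i =>
        (φ i).toHom (a (σ i)) ∘L ContinuousLinearMap.proj i
      map_smul' := fun c a => by
        ext x i
        exact congrArg (· (x i)) (map_smul (φ i).toHom c (a (σ i)))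
      map_zero' := by
        ext x i
        exact congrArg (· (x i)) (map_zero (φ i).toHom)
      map_add' := fun a b => by
        ext x i
        exact congrArg (· (x i)) (map_add (φ i).toHom (a (σ i)) (b (σ i)))
      map_mul' := fun a b => by
        ext x i
        exact congrArg (· (x i)) (map_mul (φ i).toHom (a (σ i)) (b (σ i))) }
  adjoint a x y := funext fun i => (φ i).adjoint (a (σ i)) (x i) (y i)

theorem pi_toHom (φ : ∀ i, LeftAction (A (σ i)) (B i) (Y i)) (a : ∀ i, A i) (x : ∀ i, Y i)
    (i : ι) : (pi φ).toHom a x i = (φ i).toHom (a (σ i)) (x i) := rfl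

/-- A block-diagonal operator is the finite sum of its corner-embedded blocks. -/
theorem pi_isProper {φ : ∀ i, LeftAction (A (σ i)) (B i) (Y i)} (h : ∀ i, (φ i).IsProper) :
    (pi φ).IsProper := by
  classical
  intro a
  have : (pi φ).toHom a = ∑ i, ContinuousLinearMap.single ℂ Y i ∘L
      (φ i).toHom (a (σ i)) ∘L ContinuousLinearMap.proj i := by
    ext x j
    rw [pi_toHom, sum_apply, Finset.sum_apply]
    change _ = ∑ i, (Pi.single i ((φ i).toHom (a (σ i)) (x i)) : ∀ i, Y i) j
    rw [Finset.sum_pi_single, if_pos (Finset.mem_univ j)]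
  rw [this]
  exact Submodule.sum_mem _ fun i _ => single_comp_proj_mem_compacts (h i _)

end Pi

end LeftAction

/-! ### Multiplication on quotients and the extended product system -/

namespace IsTensorIso

variable {A B C : Type u} {X Y Z : Type v} [NonUnitalCStarAlgebra A]
  [NonUnitalCStarAlgebra B] [NonUnitalCStarAlgebra C]
  [NormedAddCommGroup X] [NormedSpace ℂ X] [HilbertModule B X]
  [NormedAddCommGroup Y] [NormedSpace ℂ Y] [HilbertModule C Y]
  [NormedAddCommGroup Z] [NormedSpace ℂ Z] [HilbertModule C Z]
  {φX : LeftAction A B X} {φY : LeftAction B C Y} {φZ : LeftAction A C Z}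
  {μ : X ⊗[ℂ] Y →ₗ[ℂ] Z}

/-- The bilinear map induced on the quotients `X / X·I` and `Y / Y·J`, if `I` maps `Y` into
`Y·J`. -/
noncomputable def quotMul (h : IsTensorIso φX φY φZ μ) {I : ClosedIdeal B} {J : ClosedIdeal C}
    (hIJ : ∀ b ∈ I.toSubmodule, ∀ y, φY.toHom b y ∈ mulIdeal Y J) :
    ModQuot X I →ₗ[ℂ] ModQuot Y J →ₗ[ℂ] ModQuot Z J :=
  (mulIdeal X I).liftQ
    { toFun := fun x => (mulIdeal Y J).liftQ (modQuot J ∘ₗ TensorProduct.curry μ x) fun _ hy =>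
        (Submodule.Quotient.mk_eq_zero _).2 (h.mem_mulIdeal_right x hy)
      map_add' := fun x x' => by
        ext y
        exact congrArg (modQuot J) (by rw [map_add]; rfl : TensorProduct.curry μ (x + x') y = _)
      map_smul' := fun c x => by
        ext y
        exact congrArg (modQuot J) (by rw [map_smul]; rfl : TensorProduct.curry μ (c • x) y = _) }
    fun _ hx => by
      ext y
      exact (Submodule.Quotient.mk_eq_zero _).2 (h.mem_mulIdeal_left hIJ hx y)

end IsTensorIso

namespace ProductSystem

variable {n : ℕ} {A : Type u} [NonUnitalCStarAlgebra A]
  {X : (Fin n → ℕ) → Type v} [∀ m, NormedAddCommGroup (X m)] [∀ m, NormedSpace ℂ (X m)]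
  [∀ m, HilbertModule A (X m)]

/-- The element of `⨁_F X_{K F}` with given lifts of its components. -/
def extMk (K : Finset (Fin n) → ClosedIdeal A) {E : Type v} [NormedAddCommGroup E]
    [NormedSpace ℂ E] [HilbertModule A E] (x : Finset (Fin n) → E) : ExtMod K E :=
  fun F => modQuot (K F) (x F)

theorem exists_extMk (K : Finset (Fin n) → ClosedIdeal A) {E : Type v} [NormedAddCommGroup E]
    [NormedSpace ℂ E] [HilbertModule A E] (q : ExtMod K E) : ∃ x, extMk K x = q := by
  choose x hx using fun F => (mulIdeal E (K F)).mkQ_surjective (q F)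
  exact ⟨x, funext hx⟩

theorem exists_quot (K : Finset (Fin n) → ClosedIdeal A) (q : ExtAlg K) :
    ∃ a : Finset (Fin n) → A, (fun F => (K F).quot (a F)) = q := by
  choose a ha using fun F => (K F).quot_surjective (q F)
  exact ⟨a, funext ha⟩

/-- Lets the degree cast in associativity act on lifts, where associativity of `P` applies. -/
theorem cast_extMk (K : Finset (Fin n) → ClosedIdeal A) {m k : Fin n → ℕ} (h : m = k)
    (x : Finset (Fin n) → X m) :
    cast (congrArg (fun m => ExtMod K (X m)) h) (extMk K x) =
      extMk K fun F => cast (congrArg X h) (x F) := by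
  subst h
  rfl

variable (P : ProductSystem n A X) {K : Finset (Fin n) → ClosedIdeal A}

/-- The identification of the quotients of `A` and `X 0` by a closed ideal. -/
noncomputable def quotZero (I : ClosedIdeal A) : I.Quot ≃ₗ[ℂ] ModQuot (X 0) I :=
  Submodule.Quotient.equiv I.toSubmodule (mulIdeal (X 0) I) P.zero (by
    ext z
    obtain ⟨a, rfl⟩ := P.zero.surjective z
    rw [zero_mem_mulIdeal_iff]
    simp)

/-- The left action of `A_K` on `⨁_F X_{K F}`. -/
noncomputable def extLeft (hK : P.IsInvariantFamily K) (m : Fin n → ℕ) :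
    LeftAction (ExtAlg K) (ExtAlg K) (ExtMod K (X m)) :=
  LeftAction.pi (A := fun F => (K F).Quot) (B := fun F => (K F).Quot)
    (σ := fun F => F \ multiSupp m) fun F => (P.left m).quotient (hK.toHom_mem m F)

theorem extLeft_apply (hK : P.IsInvariantFamily K) (m : Fin n → ℕ) (a : Finset (Fin n) → A)
    (x : Finset (Fin n) → X m) :
    (P.extLeft hK m).toHom (fun F => (K F).quot (a F)) (extMk K x) =
      extMk K fun F => (P.left m).toHom (a (F \ multiSupp m)) (x F) := rfl

/-- The multiplication of `⨁_F X_{K F}`. -/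
noncomputable def extMul (hK : P.IsInvariantFamily K) (m k : Fin n → ℕ) (hm : m ≠ 0) (hk : k ≠ 0) :
    ExtMod K (X m) ⊗[ℂ] ExtMod K (X k) →ₗ[ℂ] ExtMod K (X (m + k)) :=
  LinearMap.pi fun F => TensorProduct.lift
    (((P.isTensorIso m k hm hk).quotMul (hK.toHom_mem k F)).compl₁₂
      (LinearMap.proj (F \ multiSupp k)) (LinearMap.proj F))

theorem extMul_tmul (hK : P.IsInvariantFamily K) {m k : Fin n → ℕ} (hm : m ≠ 0) (hk : k ≠ 0)
    (x : Finset (Fin n) → X m) (y : Finset (Fin n) → X k) :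
    P.extMul hK m k hm hk (extMk K x ⊗ₜ extMk K y) =
      extMk K fun F => P.mul m k hm hk (x (F \ multiSupp k) ⊗ₜ y F) := rfl

/-- A right factor supported in the summand `F` yields a product supported there, so density in each
`X (m + k)` suffices. -/
theorem denseRange_extMul (hK : P.IsInvariantFamily K) {m k : Fin n → ℕ} (hm : m ≠ 0)
    (hk : k ≠ 0) : DenseRange (P.extMul hK m k hm hk) := by
  set S := (LinearMap.range (P.extMul hK m k hm hk)).topologicalClosure with hS
  have hsingle : ∀ (F : Finset (Fin n)) (z : X (m + k)),
      (Pi.single F (modQuot (K F) z) : ExtMod K (X (m + k))) ∈ S := by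
    intro F
    let f : X (m + k) →L[ℂ] ExtMod K (X (m + k)) :=
      ContinuousLinearMap.single ℂ (fun F => ModQuot (X (m + k)) (K F)) F ∘L
        (mulIdeal (X (m + k)) (K F)).mkQL
    intro z
    refine (P.isTensorIso m k hm hk).dense.induction_on (p := fun z => f z ∈ S) z
      ((Submodule.isClosed_topologicalClosure _).preimage f.continuous) fun t => ?_
    induction t with
    | zero => simp
    | add s t hs ht => rw [map_add, map_add]; exact add_mem hs ht
    | tmul x y =>
      refine Submodule.le_topologicalClosure _
        -- The left factor is constant in its index because component `F` reads it at `F \ supp k`.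
        ⟨extMk K (fun _ => x) ⊗ₜ extMk K (Pi.single F y), funext fun G => ?_⟩
      rw [extMul_tmul]
      change modQuot (K G) (P.mul m k hm hk (x ⊗ₜ (Pi.single F y : Finset (Fin n) → X k) G)) =
        (Pi.single F (modQuot (K F) (P.mul m k hm hk (x ⊗ₜ y))) : ExtMod K (X (m + k))) G
      by_cases hG : G = F
      · subst hG
        rw [Pi.single_eq_same, Pi.single_eq_same]
      · rw [Pi.single_eq_of_ne hG, Pi.single_eq_of_ne hG, TensorProduct.tmul_zero, map_zero,
          map_zero]
  intro q
  obtain ⟨z, rfl⟩ := exists_extMk K q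
  have hz : extMk K z = ∑ F, (Pi.single F (modQuot (K F) (z F)) : ExtMod K (X (m + k))) :=
    (Finset.univ_sum_single (extMk K z)).symm
  have hmem : extMk K z ∈ S := by
    rw [hz]
    exact Submodule.sum_mem _ fun F _ => hsingle F (z F)
  rwa [hS, ← SetLike.mem_coe, Submodule.topologicalClosure_coe, LinearMap.coe_range] at hmem

theorem isTensorIso_extMul (hK : P.IsInvariantFamily K) {m k : Fin n → ℕ} (hm : m ≠ 0)
    (hk : k ≠ 0) : IsTensorIso (P.extLeft hK m) (P.extLeft hK k) (P.extLeft hK (m + k))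
      (P.extMul hK m k hm hk) where
  dense := P.denseRange_extMul hK hm hk
  ip_tmul x x' y y' := by
    obtain ⟨x, rfl⟩ := exists_extMk K x
    obtain ⟨x', rfl⟩ := exists_extMk K x'
    obtain ⟨y, rfl⟩ := exists_extMk K y
    obtain ⟨y', rfl⟩ := exists_extMk K y'
    exact funext fun F => congrArg (K F).quot ((P.isTensorIso m k hm hk).ip_tmul _ _ _ _)
  left a x y := by
    obtain ⟨a, rfl⟩ := exists_quot K a
    obtain ⟨x, rfl⟩ := exists_extMk K x
    obtain ⟨y, rfl⟩ := exists_extMk K y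
    rw [extLeft_apply, extMul_tmul, extMul_tmul, extLeft_apply]
    refine congrArg (extMk K) (funext fun F => ?_)
    -- Both sides act through the same summand of `A_K`: removing `supp k`, then `supp m`, removes
    -- `supp (m + k)`.
    rw [(P.isTensorIso m k hm hk).left, sdiff_multiSupp_add]
  right x y c := by
    obtain ⟨c, rfl⟩ := exists_quot K c
    obtain ⟨x, rfl⟩ := exists_extMk K x
    obtain ⟨y, rfl⟩ := exists_extMk K y
    exact funext fun F => congrArg (modQuot (K F)) ((P.isTensorIso m k hm hk).right _ _ _)

/-- The product system on the Hilbert modules `⨁_F X_{K F}` over `A_K`. -/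
noncomputable def ext (hK : P.IsInvariantFamily K) :
    ProductSystem n (ExtAlg K) (fun m => ExtMod K (X m)) where
  left := P.extLeft hK
  zero := LinearEquiv.piCongrRight fun F => P.quotZero (K F)
  ip_zero a b := by
    obtain ⟨a, rfl⟩ := exists_quot K a
    obtain ⟨b, rfl⟩ := exists_quot K b
    exact funext fun F => congrArg (K F).quot (P.ip_zero (a F) (b F))
  zero_act a b := by
    obtain ⟨a, rfl⟩ := exists_quot K a
    obtain ⟨b, rfl⟩ := exists_quot K b
    exact funext fun F => congrArg (modQuot (K F)) (P.zero_act (a F) (b F))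
  left_zero a b := by
    obtain ⟨a, rfl⟩ := exists_quot K a
    obtain ⟨b, rfl⟩ := exists_quot K b
    refine funext fun F => (congrArg (modQuot (K F)) (P.left_zero (a (F \ multiSupp 0)) (b F))).trans
      ?_
    rw [multiSupp_zero, Finset.sdiff_empty]
    rfl
  mul := P.extMul hK
  isTensorIso _ _ hm hk := P.isTensorIso_extMul hK hm hk
  assoc m k l hm hk hl hmk hkl x y z := by
    obtain ⟨x, rfl⟩ := exists_extMk K x
    obtain ⟨y, rfl⟩ := exists_extMk K y
    obtain ⟨z, rfl⟩ := exists_extMk K z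
    rw [extMul_tmul, extMul_tmul, cast_extMk K (add_assoc m k l), extMul_tmul, extMul_tmul]
    refine congrArg (extMk K) (funext fun F => ?_)
    -- The component of `x` is read at `(F \ supp l) \ supp k` on one side and at `F \ supp (k + l)`
    -- on the other.
    rw [P.assoc m k l hm hk hl hmk hkl, sdiff_multiSupp_add]

end ProductSystem

theorem propositionp {n : ℕ} {A : Type u} [NonUnitalCStarAlgebra A]
    {X : (Fin n → ℕ) → Type v} [∀ m, NormedAddCommGroup (X m)] [∀ m, NormedSpace ℂ (X m)]
    [∀ m, HilbertModule A (X m)] (P : ProductSystem n A X) (hP : P.IsProper)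
    (K : Finset (Fin n) → ClosedIdeal A) (hK : P.IsInvariantFamily K) :
    ∃ Q : ProductSystem n (ExtAlg K) (fun m => ExtMod K (X m)),
      Q.IsProper ∧
      (∀ (m : Fin n → ℕ) (a : Finset (Fin n) → A) (x : Finset (Fin n) → X m)
          (F : Finset (Fin n)),
        (Q.left m).toHom (fun G => (K G).quot (a G)) (fun G => modQuot (K G) (x G)) F =
          modQuot (K F) ((P.left m).toHom (a (F \ multiSupp m)) (x F))) ∧
      (∀ a : Finset (Fin n) → A,
        Q.zero (fun F => (K F).quot (a F)) = fun F => modQuot (K F) (P.zero (a F))) ∧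
      (∀ (m k : Fin n → ℕ) (hm : m ≠ 0) (hk : k ≠ 0) (x : Finset (Fin n) → X m)
          (y : Finset (Fin n) → X k) (F : Finset (Fin n)),
        Q.mul m k hm hk ((fun G => modQuot (K G) (x G)) ⊗ₜ[ℂ] (fun G => modQuot (K G) (y G))) F =
          modQuot (K F) (P.mul m k hm hk (x (F \ multiSupp k) ⊗ₜ[ℂ] y F))) := by
  refine ⟨P.ext hK, fun m => ?_, fun m a x F => rfl, fun a => rfl, fun m k hm hk x y F => rfl⟩
  exact LeftAction.pi_isProper fun F =>
    LeftAction.quotient_isProper (hP m) (hK.toHom_mem m F)
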